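/- **Formulae and provability.** Formulae of propositional linear logic without variables are generated by $0, 1, A\otimes B, A\oplus B, ?A$ (the positive ones) and $\top,\bot,A ⅋ B, A\,\&\,B, !A$ (the negative ones); $A^\bot$ is the De Morgan dual. $\mathrm{LL}_T$ is the usual one-sided sequent calculus of linear logic (identity, cut, exchange, $1$, $\bot$, $\top$, $⅋$, $\oplus$, $\&$, dereliction, weakening, contraction, promotion), with the tensor rule replaced by: from $\vdash\Gamma,?\Theta,A$ and $\vdash\Delta,?\Theta,B$ infer $\vdash\Gamma,\Delta,?\Theta,A\otimes B$. **Positions.** A position is a finite tree whose edges are directed and labelled by positive formulae, whose vertices have a sign $P$ (proponent) or $O$ (opponent), and in which one vertex holds the token. An edge $x\to y$ labelled by a negative formula $A$ stands for the edge $y\to x$ labelled $A^\bot$. Positions are considered up to isomorphism. **Moves.** Let $v$ be the vertex holding the token. - Along an edge $v'\to v$, the token may be passed to $v'$. - If the only edge at $v$ is $v\xrightarrow{1}v'$, then $v$ and this edge may be deleted, the token passing to $v'$. - An edge $v\xrightarrow{A\oplus B}v'$ may be relabelled $A$, or $B$, and an edge $v\xrightarrow{?A}v'$ may be relabelled $A$,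 the token passing to $v'$. - An edge $v\xrightarrow{?A}v'$ may be erased together with the whole subtree on the side of $v'$, the token staying at $v$. - Given an edge $v\xrightarrow{A\otimes B}v'$, divide the other subtrees attached to $v$ into three families $\Gamma,\Gamma',\Theta$, where those of $\Theta$ are attached by edges going out of $v$ labelled by formulae of the form $?C$. Replace $v$ by two vertices $v_1,v_2$ of the same sign, with edges $v_1\xrightarrow{A}v'$ and $v_2\xrightarrow{B}v'$; attach $\Gamma$ and a copy of $\Theta$ to $v_1$, $\Gamma'$ and another copy of $\Theta$ to $v_2$; the token passes to $v'$. **Strategies and validity.** A play from $U$ is a path of moves starting at $U$. A strategy on $U$ is a prefix-closed set of plays from $U$ that contains the empty play, is stable under isomorphism of plays (position by position), and contains every extension of its plays by one move made by an opponent. It is winning if, at the end of each of its plays that has no proper extension in it, the token is held by an opponent. A formula $A$ is *valid* if there is a tree $U$ with a chosen vertex, all of whose vertices are proponents, such that for every tree $V$ with a chosen vertex, all of whose vertices are opponents, there is a winning strategy on the tree obtained by adding to $U$ and $V$ an edge labelled $A$ from the chosen vertex of $U$ to that of $V$, wherever the token is placed initially. **Theorem.** 1. All plays are finite: there is no infinite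 sequence of moves. 2. For no formula $A$ are $A$ and $A^\bot$ both valid. 3. Every formula provable in $\mathrm{LL}_T$ is valid. -/

import Mathlib

namespace LLGame

/-- Propositional formulae of linear logic (units, no propositional variables).
`quest A` is `?A`, `bang A` is `!A`. -/
inductive Formula : Type
  | zero | one
  | tens (A B : Formula)
  | plus (A B : Formula)
  | quest (A : Formula)
  | top | bot
  | par (A B : Formula)
  | wth (A B : Formula)
  | bang (A : Formula)

namespace Formula

/-- De Morgan duality (linear negation). -/
def dual : Formula → Formula
  | zero => top
  | one => bot
  | tens A B => par (dual A) (dual B)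
  | plus A B => wth (dual A) (dual B)
  | quest A => bang (dual A)
  | top => zero
  | bot => one
  | par A B => tens (dual A) (dual B)
  | wth A B => plus (dual A) (dual B)
  | bang A => quest (dual A)

/-- The positive formulae are `0`, `1`, `A ⊗ B`, `A ⊕ B` and `?A`; the others are negative. -/
def IsPositive : Formula → Prop
  | zero | one | tens _ _ | plus _ _ | quest _ => True
  | top | bot | par _ _ | wth _ _ | bang _ => False

end Formula

open Formula

/-- Provability of one-sided sequents (lists of formulae) in the variant of linear logic in which
the tensor rule is allowed to share a context consisting of `?`-formulae. All the other rules are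
the usual ones of propositional linear logic, contraction and cut included. -/
inductive Provable : List Formula → Prop
  | ax (A : Formula) : Provable [A, dual A]
  | cut (A : Formula) (Γ Δ : List Formula) :
      Provable (A :: Γ) → Provable (dual A :: Δ) → Provable (Γ ++ Δ)
  | exchange (Γ Δ : List Formula) : Γ.Perm Δ → Provable Γ → Provable Δ
  | one : Provable [Formula.one]
  | bot (Γ : List Formula) : Provable Γ → Provable (Formula.bot :: Γ)
  | top (Γ : List Formula) : Provable (Formula.top :: Γ)
  | tens (A B : Formula) (Γ Δ Θ : List Formula) :
      Provable (A :: (Γ ++ Θ.map quest)) → Provable (B :: (Δ ++ Θ.map quest)) →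
      Provable (Formula.tens A B :: (Γ ++ Δ ++ Θ.map quest))
  | par (A B : Formula) (Γ : List Formula) :
      Provable (A :: B :: Γ) → Provable (Formula.par A B :: Γ)
  | plusLeft (A B : Formula) (Γ : List Formula) :
      Provable (A :: Γ) → Provable (plus A B :: Γ)
  | plusRight (A B : Formula) (Γ : List Formula) :
      Provable (B :: Γ) → Provable (plus A B :: Γ)
  | wth (A B : Formula) (Γ : List Formula) :
      Provable (A :: Γ) → Provable (B :: Γ) → Provable (Formula.wth A B :: Γ)
  | dereliction (A : Formula) (Γ : List Formula) :
      Provable (A :: Γ) → Provable (quest A :: Γ)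
  | weakening (A : Formula) (Γ : List Formula) :
      Provable Γ → Provable (quest A :: Γ)
  | contraction (A : Formula) (Γ : List Formula) :
      Provable (quest A :: quest A :: Γ) → Provable (quest A :: Γ)
  | promotion (A : Formula) (Γ : List Formula) :
      Provable (A :: Γ.map quest) → Provable (bang A :: Γ.map quest)

/-- The two teams: `P` (proponents) and `O` (opponents). -/
inductive Sign : Type
  | P | O

/-- Finite, punctured, directed, signed, normally labelled trees. A tree is presented from its
selected vertex, the one holding the token, which is the root of the term: `node s Γ` is the tree
whose selected vertex has sign `s`, and whose edges at that vertex are listed in `Γ`, each together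
with the subtree at its other end, presented from that end.

Edges are given by the formula seen from the parent: an entry `(A, t)` with `A` positive is an edge
directed from the vertex to the root of `t` and labelled `A`; an entry `(A, t)` with `A` negative is
an edge directed from the root of `t` to the vertex and labelled `dual A`. The same edge, seen from
the root of `t`, is the formula `dual A`. So the first components of `Γ` form the sequent of the
selected vertex. -/
inductive Pos : Type
  | node (s : Sign) (Γ : List (Formula × Pos)) : Pos

namespace Pos

/-- The sign of the vertex holding the token. -/
def sign : Pos → Sign
  | node s _ => s

/-- Isomorphism of positions (preserving token, signs, directions and labels): the edges at any
vertex may be listed in any order. -/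
inductive Iso : Pos → Pos → Prop
  | refl (t : Pos) : Iso t t
  | trans {t u v : Pos} : Iso t u → Iso u v → Iso t v
  | perm (s : Sign) {Γ Δ : List (Formula × Pos)} : Γ.Perm Δ → Iso (node s Γ) (node s Δ)
  | congr (s : Sign) (A : Formula) (Γ : List (Formula × Pos)) {t u : Pos} :
      Iso t u → Iso (node s ((A, t) :: Γ)) (node s ((A, u) :: Γ))

/-- All the vertices of the tree have sign `s`. -/
inductive AllSign (s : Sign) : Pos → Prop
  | node (Γ : List (Formula × Pos)) : (∀ x ∈ Γ, AllSign s x.2) → AllSign s (node s Γ)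

/-- `link U A V` is the tree obtained from the disjoint union of `U` and `V` by adding an edge
labelled `A` from the selected vertex of `U` to that of `V` (normalised if `A` is negative).
The token is held by the selected vertex of `U`. -/
def link : Pos → Formula → Pos → Pos
  | node s Γ, A, V => node s ((A, V) :: Γ)

/-- `Repuncture t u`: up to isomorphism, `u` is the same tree as `t`, the token being placed at
an arbitrary vertex. (One step moves the token across one edge, regardless of its direction.) -/
inductive Repuncture (t : Pos) : Pos → Prop
  | refl : Repuncture t t
  | iso {u v : Pos} : Repuncture t u → Iso u v → Repuncture t v
  | step (s s' : Sign) (A : Formula) (Γ Δ : List (Formula × Pos)) :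
      Repuncture t (node s ((A, node s' Δ) :: Γ)) → Repuncture t (node s' ((dual A, node s Γ) :: Δ))

/-- The moves of the naive game, up to isomorphism. In each of them the active vertex is the root
of the left-hand position; `s` is its sign and `s'` is the sign of the passive vertex. -/
inductive BasicMove : Pos → Pos → Prop
  /-- The token is passed along an input edge, labelled by the positive formula `A`. -/
  | neg (s s' : Sign) (A : Formula) (Γ Δ : List (Formula × Pos)) : A.IsPositive →
      BasicMove (node s ((dual A, node s' Δ) :: Γ)) (node s' ((A, node s Γ) :: Δ))
  /-- If its sole edge is an output `1`, the active vertex passes the token along it, and is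
  deleted together with the edge. -/
  | one (s s' : Sign) (Δ : List (Formula × Pos)) :
      BasicMove (node s [(Formula.one, node s' Δ)]) (node s' Δ)
  /-- The active vertex splits in two; the subtrees in `Θ`, all attached by outputs of the shape
  `?C`, are duplicated. -/
  | tens (s s' : Sign) (A B : Formula) (Γ Θ Γ' Δ : List (Formula × Pos)) :
      (∀ x ∈ Θ, ∃ C, x.1 = quest C) →
      BasicMove (node s ((Formula.tens A B, node s' Δ) :: (Γ ++ Θ ++ Γ')))
        (node s' ((dual A, node s (Γ ++ Θ)) :: (dual B, node s (Γ' ++ Θ)) :: Δ))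
  | plusLeft (s s' : Sign) (A B : Formula) (Γ Δ : List (Formula × Pos)) :
      BasicMove (node s ((plus A B, node s' Δ) :: Γ)) (node s' ((dual A, node s Γ) :: Δ))
  | plusRight (s s' : Sign) (A B : Formula) (Γ Δ : List (Formula × Pos)) :
      BasicMove (node s ((plus A B, node s' Δ) :: Γ)) (node s' ((dual B, node s Γ) :: Δ))
  | dereliction (s s' : Sign) (A : Formula) (Γ Δ : List (Formula × Pos)) :
      BasicMove (node s ((quest A, node s' Δ) :: Γ)) (node s' ((dual A, node s Γ) :: Δ))
  /-- An output `?A` is erased together with the whole subtree at its other end; the active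
  vertex keeps the token. -/
  | weakening (s : Sign) (A : Formula) (t : Pos) (Γ : List (Formula × Pos)) :
      BasicMove (node s ((quest A, t) :: Γ)) (node s Γ)

/-- The moves of the naive game, as a reduction relation on positions invariant under
isomorphism. -/
def Move (U V : Pos) : Prop :=
  ∃ U' V', Iso U U' ∧ BasicMove U' V' ∧ Iso V' V

end Pos

/-- `[U₁, …, Uₙ]` is a (finite) play from `U` if `U → U₁ → ⋯ → Uₙ` is a path in the graph of
positions and moves. The empty list is the empty play. -/
def IsPlay (U : Pos) (p : List Pos) : Prop :=
  List.IsChain Pos.Move (U :: p)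

/-- The final position of a play `p` from `U`. -/
def finalPos (U : Pos) (p : List Pos) : Pos :=
  (U :: p).getLast (List.cons_ne_nil U p)

/-- Strategies (for the proponents) on a position `U`. -/
structure IsStrategy (U : Pos) (S : Set (List Pos)) : Prop where
  plays : ∀ p ∈ S, IsPlay U p
  empty_mem : [] ∈ S
  prefix_closed : ∀ p q : List Pos, p <+: q → q ∈ S → p ∈ S
  /-- A strategy contains two isomorphic plays from `U` at the same time. -/
  iso_stable : ∀ p q : List Pos, p ∈ S → IsPlay U q → List.Forall₂ Pos.Iso p q → q ∈ S
  /-- Any move by an opponent is accepted. -/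
  welcoming : ∀ p ∈ S, (finalPos U p).sign = Sign.O →
    ∀ V, Pos.Move (finalPos U p) V → p ++ [V] ∈ S

/-- A strategy is winning if, at the end of each of its maximal plays, the token is held by an
opponent. -/
def IsWinning (U : Pos) (S : Set (List Pos)) : Prop :=
  ∀ p ∈ S, (∀ q ∈ S, p <+: q → q = p) → (finalPos U p).sign = Sign.O

/-- Game validity of a formula `A`: there is a tree `U` (of proponents) such that for all trees `V`
(of opponents), the proponents have a winning strategy on the tree obtained by linking `U` to `V`
by an edge labelled `A`, wherever the token is placed initially. -/
def Valid (A : Formula) : Prop :=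
  ∃ U : Pos, U.AllSign Sign.P ∧ ∀ V : Pos, V.AllSign Sign.O →
    ∀ W : Pos, (Pos.link U A V).Repuncture W → ∃ S : Set (List Pos), IsStrategy W S ∧ IsWinning W S

end LLGame

/-!
Realizability is defined relative to a set `Q` of positions: a tree realizes `A` if every position
obtained by testing it against realizers of the dual formulae belongs to `Q`. When `Q` contains
every position with the token at a vertex of sign `s` as soon as all its moves stay in `Q`, any
vertex of sign `s` surrounded by realizers is itself a realizer, because each of its moves makes its
sequent smaller. For the set of positions without infinite play this holds for both signs, and
termination follows by induction on trees. For the set of winning positions it holds for the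
opponents only.

Proponent vertices are justified by proofs instead. Identities are interpreted by copycat, a cut on
`A` by an extra edge `?(A ⊗ A⊥)` leading to a leaf; contraction is a cut against a proof that uses
the shared context of the tensor rule. Soundness of the sequent at each proponent vertex is
a condition that does not mention the token, hence the proponents win wherever it is placed.
Consistency holds because exchanging the teams turns a winning position into a losing one.
-/

namespace LLGame

theorem perm_append_right_comm {α : Type*} (k l m : List α) :
    (k ++ l ++ m).Perm (k ++ m ++ l) := by
  simpa using List.perm_append_comm.append_left k

namespace Formula

@[simp] theorem dual_dual (A : Formula) : A.dual.dual = A := by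
  induction A <;> simp_all [dual]

theorem isPositive_or_dual (A : Formula) : A.IsPositive ∨ A.dual.IsPositive := by
  cases A <;> simp [IsPositive, dual]

theorem IsPositive.not_dual {A : Formula} (hA : A.IsPositive) : ¬ A.dual.IsPositive := by
  cases A <;> simp_all [IsPositive, dual]

/-- The number of connectives and units of a formula. -/
def size : Formula → ℕ
  | zero | one | top | bot => 1
  | tens A B | plus A B | par A B | wth A B => size A + size B + 1
  | quest A | bang A => size A + 1

@[simp] theorem size_dual (A : Formula) : A.dual.size = A.size := by
  induction A <;> simp_all [dual, size]

theorem size_pos (A : Formula) : 0 < A.size := by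
  cases A <;> simp [size]

/-- The total size of the formulae of a sequent. -/
def sequentSize (Γ : List Formula) : ℕ := (Γ.map size).sum

@[simp] theorem sequentSize_cons (A : Formula) (Γ : List Formula) :
    sequentSize (A :: Γ) = A.size + sequentSize Γ := by
  simp [sequentSize]

@[simp] theorem sequentSize_append (Γ Δ : List Formula) :
    sequentSize (Γ ++ Δ) = sequentSize Γ + sequentSize Δ := by
  simp [sequentSize]

theorem size_le_sequentSize {A : Formula} {Γ : List Formula} (hA : A ∈ Γ) :
    A.size ≤ sequentSize Γ :=
  List.le_sum_of_mem (List.mem_map_of_mem hA)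

theorem sequentSize_eq_of_perm {Γ Δ : List Formula} (h : Γ.Perm Δ) :
    sequentSize Γ = sequentSize Δ :=
  (h.map size).sum_eq

theorem sequentSize_map_fst_le_of_subperm {α : Type*} {Γ Δ : List (Formula × α)}
    (h : Γ.Subperm Δ) : sequentSize (Γ.map Prod.fst) ≤ sequentSize (Δ.map Prod.fst) := by
  obtain ⟨Γ', hperm, hsub⟩ := h
  rw [← sequentSize_eq_of_perm (hperm.map _)]
  exact ((hsub.map Prod.fst).map size).sum_le_sum fun _ _ => Nat.zero_le _

/-- The sequents that can stand for the formula `A` at a vertex when the token arrives there from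
the other end of the edge `A`: if `A` is negative then it has just been decomposed by the other end,
if it is positive then it is still there. -/
def decompositions : Formula → Set (List Formula)
  | top => ∅
  | bot => {[]}
  | par A B => {[A, B]}
  | wth A B => {[A], [B]}
  | bang A => {[A]}
  | A => {[A]}

theorem decompositions_of_isPositive {A : Formula} (hA : A.IsPositive) :
    A.decompositions = {[A]} := by
  cases A <;> first | rfl | exact hA.elim

theorem sequentSize_lt_of_mem_decompositions {A : Formula} (hA : A.dual.IsPositive)
    {C : List Formula} (hC : C ∈ A.decompositions) : sequentSize C < A.size := by
  cases A with
  | top => exact hC.elim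
  | wth A B => obtain rfl | rfl := hC <;> simp [sequentSize, size]
  | bot | par A B | bang A => obtain rfl := hC; simp [sequentSize, size]
  | _ => exact hA.elim

theorem sequentSize_le_of_mem_decompositions {A : Formula} {C : List Formula}
    (hC : C ∈ A.decompositions) : sequentSize C ≤ A.size := by
  obtain hA | hA := A.isPositive_or_dual
  · rw [decompositions_of_isPositive hA, Set.mem_singleton_iff] at hC
    simp [hC, sequentSize]
  · exact (sequentSize_lt_of_mem_decompositions hA hC).le

theorem sequentSize_lt_of_mem_decompositions_dual {A B : Formula} {C D : List Formula}
    (hC : C ∈ A.dual.decompositions) (hB : B ∈ C) (hD : D ∈ B.dual.decompositions) :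
    sequentSize D < A.size := by
  obtain hA | hA := A.isPositive_or_dual
  · calc sequentSize D ≤ B.dual.size := sequentSize_le_of_mem_decompositions hD
      _ = B.size := B.size_dual
      _ ≤ sequentSize C := size_le_sequentSize hB
      _ < A.dual.size := sequentSize_lt_of_mem_decompositions (by rwa [dual_dual]) hC
      _ = A.size := A.size_dual
  · rw [decompositions_of_isPositive hA, Set.mem_singleton_iff] at hC
    subst hC
    rw [List.mem_singleton.1 hB, dual_dual] at hD
    exact sequentSize_lt_of_mem_decompositions hA hD

open Classical in
/-- The measure on which realizability is defined by recursion. A positive formula counts a little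
more than its dual, which has the same size. -/
noncomputable def rank (A : Formula) : ℕ := 2 * A.size + if A.IsPositive then 1 else 0

theorem rank_dual_lt {A B : Formula} {C : List Formula} (hC : C ∈ A.decompositions)
    (hB : B ∈ C) : B.dual.rank < A.rank := by
  obtain hA | hA := A.isPositive_or_dual
  · rw [decompositions_of_isPositive hA, Set.mem_singleton_iff] at hC
    subst hC
    simp [List.mem_singleton.1 hB, rank, hA, hA.not_dual]
  · have hlt : B.size < A.size :=
      (size_le_sequentSize hB).trans_lt (sequentSize_lt_of_mem_decompositions hA hC)
    have hle : B.dual.rank ≤ 2 * B.size + 1 := by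
      simp only [rank, size_dual]
      split_ifs <;> omega
    simp only [rank] at hle ⊢
    omega

end Formula

open Formula

namespace Pos

theorem sizeOf_lt_of_mem {s : Sign} {Γ : List (Formula × Pos)} {x : Formula × Pos} (hx : x ∈ Γ) :
    sizeOf x.2 < sizeOf (node s Γ) := by
  have := List.sizeOf_lt_of_mem hx
  cases x
  simp only [node.sizeOf_spec, Prod.mk.sizeOf_spec] at this ⊢
  omega

@[elab_as_elim]
theorem induction_on_subtrees {C : Pos → Prop} (t : Pos)
    (node : ∀ s Γ, (∀ x ∈ Γ, C x.2) → C (node s Γ)) : C t :=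
  match t with
  | .node s Γ => node s Γ fun x _ => induction_on_subtrees x.2 node
termination_by sizeOf t
decreasing_by exact sizeOf_lt_of_mem ‹_›

/-- The tree obtained from `t` by adding the edges `l` at the selected vertex. -/
def attach (l : List (Formula × Pos)) : Pos → Pos
  | node s Γ => node s (l ++ Γ)

theorem Iso.symm {t u : Pos} (h : Iso t u) : Iso u t := by
  induction h with
  | refl => exact .refl _
  | trans _ _ h₁ h₂ => exact h₂.trans h₁
  | perm s h => exact .perm s h.symm
  | congr s A Γ _ h => exact .congr s A Γ h

theorem Iso.attach (l : List (Formula × Pos)) {t u : Pos} (h : Iso t u) :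
    Iso (t.attach l) (u.attach l) := by
  induction h with
  | refl => exact .refl _
  | trans _ _ h₁ h₂ => exact h₁.trans h₂
  | perm s h => exact .perm s (h.append_left l)
  | congr s A Γ h _ =>
    exact ((Iso.perm s List.perm_middle).trans (.congr s A _ h)).trans
      (.perm s List.perm_middle.symm)

theorem Iso.exists_eq_node {s : Sign} {Γ : List (Formula × Pos)} {t : Pos}
    (h : Iso (node s Γ) t) :
    ∃ Δ, t = node s Δ ∧ (Γ.map Prod.fst).Perm (Δ.map Prod.fst) ∧
      ∀ y ∈ Δ, ∃ x ∈ Γ, x.1 = y.1 ∧ Iso x.2 y.2 := by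
  generalize hu : node s Γ = u at h
  induction h generalizing Γ with
  | refl => exact ⟨Γ, hu.symm, .refl _, fun x hx => ⟨x, hx, rfl, .refl _⟩⟩
  | trans _ _ ih₁ ih₂ =>
    obtain ⟨Δ, hΔ, hperm, hsub⟩ := ih₁ hu
    obtain ⟨Ξ, rfl, hperm', hsub'⟩ := ih₂ hΔ.symm
    refine ⟨Ξ, rfl, hperm.trans hperm', fun z hz => ?_⟩
    obtain ⟨y, hy, hyz, hiso'⟩ := hsub' z hz
    obtain ⟨x, hx, hxy, hiso⟩ := hsub y hy
    exact ⟨x, hx, hxy.trans hyz, hiso.trans hiso'⟩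
  | perm _ h =>
    cases hu
    exact ⟨_, rfl, h.map _, fun x hx => ⟨x, h.mem_iff.2 hx, rfl, .refl _⟩⟩
  | congr _ A Ξ h =>
    cases hu
    refine ⟨_, rfl, .refl _, List.forall_mem_cons.2 ⟨⟨_, List.mem_cons_self, rfl, h⟩, ?_⟩⟩
    exact fun x hx => ⟨x, List.mem_cons_of_mem _ hx, rfl, .refl _⟩

theorem Iso.sign_eq {t u : Pos} (h : Iso t u) : t.sign = u.sign := by
  cases t
  obtain ⟨Δ, rfl, -⟩ := h.exists_eq_node
  rfl

theorem BasicMove.move {t u : Pos} (h : BasicMove t u) : Move t u :=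
  ⟨t, u, .refl _, h, .refl _⟩

theorem Move.of_iso {t t' u : Pos} (h : Iso t t') : Move t' u → Move t u
  | ⟨v, w, hv, hm, hw⟩ => ⟨v, w, h.trans hv, hm, hw⟩

theorem BasicMove.eq_attach_or_eq_tail {s : Sign} {Γ₀ : List (Formula × Pos)} {v : Pos}
    (h : BasicMove (node s Γ₀) v) :
    (∃ A u Γ l, Γ₀ = (A, u) :: Γ ∧ v = u.attach l ∧ l.map Prod.fst ∈ A.dual.decompositions ∧
      ∀ x ∈ l, ∃ Δ, x.2 = node s Δ ∧ Δ.Subperm Γ) ∨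
    ∃ x Γ, Γ₀ = x :: Γ ∧ v = node s Γ := by
  cases h with
  | neg s s' A Γ Δ hA =>
    refine .inl ⟨A.dual, node s' Δ, Γ, [(A, node s Γ)], rfl, rfl, ?_, ?_⟩
    · simp [decompositions_of_isPositive hA]
    · simpa using List.Subperm.refl Γ
  | one s s' Δ => exact .inl ⟨.one, node s' Δ, [], [], rfl, rfl, rfl, by simp⟩
  | tens s s' A B Γ Θ Γ' Δ =>
    refine .inl ⟨.tens A B, node s' Δ, Γ ++ Θ ++ Γ',
      [(A.dual, node s (Γ ++ Θ)), (B.dual, node s (Γ' ++ Θ))], rfl, rfl, rfl, ?_⟩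
    have hleft : (Γ ++ Θ).Subperm (Γ ++ Θ ++ Γ') := (List.sublist_append_left _ _).subperm
    have hright : (Γ' ++ Θ).Subperm (Γ ++ Θ ++ Γ') :=
      List.perm_append_comm.subperm.trans ((List.sublist_append_right Γ Θ).append_right Γ').subperm
    exact List.forall_mem_cons.2 ⟨⟨_, rfl, hleft⟩, List.forall_mem_singleton.2 ⟨_, rfl, hright⟩⟩
  | plusLeft s s' A B Γ Δ =>
    exact .inl ⟨plus A B, node s' Δ, Γ, [(A.dual, node s Γ)], rfl, rfl, .inl rfl,
      by simpa using List.Subperm.refl Γ⟩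
  | plusRight s s' A B Γ Δ =>
    exact .inl ⟨plus A B, node s' Δ, Γ, [(B.dual, node s Γ)], rfl, rfl, .inr rfl,
      by simpa using List.Subperm.refl Γ⟩
  | dereliction s s' A Γ Δ =>
    exact .inl ⟨quest A, node s' Δ, Γ, [(A.dual, node s Γ)], rfl, rfl, rfl,
      by simpa using List.Subperm.refl Γ⟩
  | weakening s A t Γ => exact .inr ⟨(quest A, t), Γ, rfl, rfl⟩

theorem basicMove_attach {A : Formula} (hA : A.IsPositive) (s : Sign) (u : Pos)
    {l : List (Formula × List (Formula × Pos))} (hl : l.map Prod.fst ∈ A.dual.decompositions) :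
    BasicMove (node s ((A, u) :: (l.map Prod.snd).flatten))
      (u.attach (l.map fun x => (x.1, node s x.2))) := by
  obtain ⟨s', Δ⟩ := u
  cases A with
  | zero => exact hl.elim
  | one =>
    obtain rfl := List.map_eq_nil_iff.1 hl
    exact .one s s' Δ
  | tens A B =>
    obtain ⟨⟨_, Γ⟩, _, rfl, rfl, htail⟩ := List.map_eq_cons_iff.1 hl
    obtain ⟨⟨_, Γ'⟩, rfl, rfl⟩ := List.map_eq_singleton_iff.1 htail
    simpa [attach] using BasicMove.tens s s' A B Γ [] Γ' Δ (by simp)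
  | plus A B =>
    obtain hl | hl := hl
    · obtain ⟨⟨_, Γ⟩, rfl, rfl⟩ := List.map_eq_singleton_iff.1 hl
      simpa [attach] using BasicMove.plusLeft s s' A B Γ Δ
    · obtain ⟨⟨_, Γ⟩, rfl, rfl⟩ := List.map_eq_singleton_iff.1 hl
      simpa [attach] using BasicMove.plusRight s s' A B Γ Δ
  | quest A =>
    obtain ⟨⟨_, Γ⟩, rfl, rfl⟩ := List.map_eq_singleton_iff.1 hl
    simpa [attach] using BasicMove.dereliction s s' A Γ Δ
  | _ => exact hA.elim

end Pos

open Pos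

section Realizability

/-- `Realizes Q A t`: the tree `t` behaves as a proof of `A`, when `Q` is the set of the positions
that are considered as correct. Whatever sequent may replace `A` at the selected vertex of `t`, the
position is correct as soon as the trees attached to the edges of this sequent realize the dual
formulae. -/
def Realizes (Q : Pos → Prop) (A : Formula) (t : Pos) : Prop :=
  ∀ l : List (Formula × Pos), l.map Prod.fst ∈ A.decompositions →
    (∀ x ∈ l, Realizes Q x.1.dual x.2) → Q (t.attach l)
termination_by A.rank
decreasing_by exact rank_dual_lt ‹_› (List.mem_map_of_mem ‹_›)

/-- The families of edges against which a realizer of `A` is tested. The type `Language` is used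
for its product, concatenation, which yields the tests of a sequent. -/
def tests (Q : Pos → Prop) (A : Formula) : Language (Formula × Pos) :=
  {l | l.map Prod.fst ∈ A.decompositions ∧ ∀ x ∈ l, Realizes Q x.1.dual x.2}

variable {Q : Pos → Prop} {A : Formula} {t u : Pos} {s : Sign} {Γ l : List (Formula × Pos)}

theorem realizes_iff : Realizes Q A t ↔ ∀ l ∈ tests Q A, Q (t.attach l) := by
  rw [Realizes]
  exact forall_congr' fun l => and_imp.symm

theorem mem_tests_of_isPositive (hA : A.IsPositive) :
    l ∈ tests Q A ↔ ∃ u, l = [(A, u)] ∧ Realizes Q A.dual u := by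
  constructor
  · rintro ⟨hl, hreal⟩
    rw [decompositions_of_isPositive hA, Set.mem_singleton_iff] at hl
    obtain ⟨⟨_, u⟩, rfl, rfl⟩ := List.map_eq_singleton_iff.1 hl
    exact ⟨u, rfl, hreal _ List.mem_cons_self⟩
  · rintro ⟨u, rfl, hu⟩
    refine ⟨?_, by simpa using hu⟩
    simp [decompositions_of_isPositive hA]

theorem Realizes.of_iso (hQ : ∀ ⦃t u⦄, Iso t u → Q t → Q u) (h : Iso t u)
    (ht : Realizes Q A t) : Realizes Q A u :=
  realizes_iff.2 fun l hl => hQ (h.attach l) (realizes_iff.1 ht l hl)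

theorem holds_of_forall_realizes (hQ : ∀ ⦃t u⦄, Iso t u → Q t → Q u)
    (hs : ∀ t : Pos, t.sign = s → (∀ u, Move t u → Q u) → Q t)
    (hΓ : ∀ x ∈ Γ, Realizes Q x.1.dual x.2) : Q (node s Γ) := by
  induction hn : sequentSize (Γ.map Prod.fst) using Nat.strong_induction_on generalizing Γ with
  | _ n ih =>
  refine hs _ rfl ?_
  rintro v ⟨_, w, hiso, hmove, hwv⟩
  refine hQ hwv ?_
  obtain ⟨Γ', rfl, hperm, hsub⟩ := hiso.exists_eq_node
  have hΓ' : ∀ y ∈ Γ', Realizes Q y.1.dual y.2 := by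
    intro y hy
    obtain ⟨x, hx, hxy, hiso⟩ := hsub y hy
    exact hxy ▸ (hΓ x hx).of_iso hQ hiso
  rw [sequentSize_eq_of_perm hperm] at hn
  obtain ⟨A, u, Δ, l, rfl, rfl, hl, hparts⟩ | ⟨x, Δ, rfl, rfl⟩ := hmove.eq_attach_or_eq_tail
  · obtain ⟨hu, hΔ⟩ := List.forall_mem_cons.1 hΓ'
    refine realizes_iff.1 hu l ⟨hl, fun x hx => ?_⟩
    obtain ⟨Δ', hxΔ', hsubperm⟩ := hparts x hx
    -- When the token returns to the moved vertex, its sequent has become strictly smaller.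
    rw [hxΔ', realizes_iff]
    rintro m ⟨hm, hmreal⟩
    refine ih _ ?_ (List.forall_mem_append.2 ⟨hmreal, fun y hy => hΔ y (hsubperm.subset hy)⟩) rfl
    have hm_lt : sequentSize (m.map Prod.fst) < A.size :=
      sequentSize_lt_of_mem_decompositions_dual hl (List.mem_map_of_mem hx) hm
    have hΔ'_le : sequentSize (Δ'.map Prod.fst) ≤ sequentSize (Δ.map Prod.fst) :=
      sequentSize_map_fst_le_of_subperm hsubperm
    simp only [List.map_cons, sequentSize_cons] at hn
    rw [List.map_append, sequentSize_append]
    omega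
  · refine ih _ ?_ (List.forall_mem_cons.1 hΓ').2 rfl
    rw [List.map_cons, sequentSize_cons] at hn
    have := x.1.size_pos
    omega

theorem realizes_of_forall_realizes (hQ : ∀ ⦃t u⦄, Iso t u → Q t → Q u)
    (hs : ∀ t : Pos, t.sign = s → (∀ u, Move t u → Q u) → Q t) (A : Formula)
    (hΓ : ∀ x ∈ Γ, Realizes Q x.1.dual x.2) : Realizes Q A (node s Γ) :=
  realizes_iff.2 fun _ hl =>
    holds_of_forall_realizes hQ hs (List.forall_mem_append.2 ⟨hl.2, hΓ⟩)

end Realizability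

theorem wellFounded_move : WellFounded (flip Move) := by
  have hQ : ∀ ⦃t u⦄, Iso t u → Acc (flip Move) t → Acc (flip Move) u :=
    fun t u h ht => .intro _ fun v hv => ht.inv (Move.of_iso h hv)
  have hs : ∀ s (t : Pos), t.sign = s → (∀ u, Move t u → Acc (flip Move) u) →
      Acc (flip Move) t := fun _ _ _ h => .intro _ h
  have hreal : ∀ (t : Pos) A, Realizes (Acc (flip Move)) A t := fun t => by
    induction t using induction_on_subtrees with
    | node s Γ ih => exact fun A => realizes_of_forall_realizes hQ (hs s) A fun x hx => ih x hx _
  exact ⟨fun ⟨s, _⟩ => holds_of_forall_realizes hQ (hs s) fun _ _ => hreal _ _⟩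


section Win

/-- The positions won by the proponents: they can reach, against any choice of the opponents, a
position where an opponent has to move and cannot. -/
inductive Win : Pos → Prop
  | opponent (U : Pos) : U.sign = .O → (∀ V, Move U V → Win V) → Win U
  | proponent (U V : Pos) : U.sign = .P → Move U V → Win V → Win U

variable {U V : Pos} {p q : List Pos} {S : Set (List Pos)} {Γ Δ : List (Formula × Pos)}

theorem Win.of_move (hU : Win U) (hs : U.sign = .O) (hm : Move U V) : Win V := by
  cases hU with
  | opponent _ _ h => exact h V hm
  | proponent _ _ h => simp [hs] at h

theorem Win.exists_move (hU : Win U) (hs : U.sign = .P) : ∃ V, Move U V ∧ Win V := by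
  cases hU with
  | opponent _ h => simp [hs] at h
  | proponent _ V _ hm hV => exact ⟨V, hm, hV⟩

theorem Win.of_iso (h : Iso U V) (hU : Win U) : Win V := by
  cases hU with
  | opponent _ hs hm => exact .opponent _ (h.sign_eq ▸ hs) fun W hW => hm W (hW.of_iso h)
  | proponent _ W hs hm hW => exact .proponent _ W (h.sign_eq ▸ hs) (hm.of_iso h.symm) hW

theorem Win.of_perm {s : Sign} (h : Γ.Perm Δ) (hΓ : Win (node s Γ)) : Win (node s Δ) :=
  hΓ.of_iso (.perm _ h)

theorem Win.of_basicMove (h : BasicMove (node .P Γ) V) (hV : Win V) : Win (node .P Γ) :=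
  .proponent _ V rfl h.move hV

theorem finalPos_append_singleton (U V : Pos) (p : List Pos) : finalPos U (p ++ [V]) = V := by
  simp [finalPos]

theorem isPlay_append_cons :
    IsPlay U (p ++ V :: q) ↔ IsPlay U p ∧ Move (finalPos U p) V ∧ IsPlay V q := by
  unfold IsPlay finalPos
  rw [← List.cons_append, List.isChain_append]
  simp [List.getLast?_eq_some_getLast, and_comm]

theorem win_of_isWinning (hS : IsStrategy U S) (hw : IsWinning U S) : Win U := by
  suffices h : ∀ V, ∀ p ∈ S, finalPos U p = V → Win V from h U [] hS.empty_mem rfl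
  intro V
  induction V using wellFounded_move.induction with
  | _ V ih =>
  rintro p hp rfl
  cases hs : (finalPos U p).sign with
  | O =>
    exact .opponent _ hs fun V hV =>
      ih V hV _ (hS.welcoming p hp hs V hV) (finalPos_append_singleton _ _ _)
  | P =>
    have hnot_maximal : ¬ ∀ q ∈ S, p <+: q → q = p := fun h => by simpa [hs] using hw p hp h
    push Not at hnot_maximal
    obtain ⟨_, hq, ⟨_ | ⟨V, q⟩, rfl⟩, hne⟩ := hnot_maximal
    · simp at hne
    · have hm := (isPlay_append_cons.1 (hS.plays _ hq)).2.1
      refine .proponent _ V hs hm (ih V hm (p ++ [V]) ?_ (finalPos_append_singleton _ _ _))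
      exact hS.prefix_closed _ _ ⟨q, by simp⟩ hq

/-- The plays on `U` that only visit won positions after `U`: a winning strategy if `U` is won. -/
def winningPlays (U : Pos) : Set (List Pos) := {p | IsPlay U p ∧ ∀ V ∈ p, Win V}

theorem append_singleton_mem_winningPlays (hp : p ∈ winningPlays U) (hm : Move (finalPos U p) V)
    (hV : Win V) : p ++ [V] ∈ winningPlays U :=
  ⟨isPlay_append_cons.2 ⟨hp.1, hm, List.isChain_singleton _⟩,
    List.forall_mem_append.2 ⟨hp.2, List.forall_mem_singleton.2 hV⟩⟩

theorem Win.finalPos_of_mem_winningPlays (hU : Win U) (hp : p ∈ winningPlays U) :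
    Win (finalPos U p) :=
  List.forall_mem_cons.2 ⟨hU, hp.2⟩ _ (List.getLast_mem _)

theorem Win.isStrategy_winningPlays (hU : Win U) : IsStrategy U (winningPlays U) where
  plays p hp := hp.1
  empty_mem := ⟨List.isChain_singleton _, by simp⟩
  prefix_closed := by
    rintro p _ ⟨q, rfl⟩ ⟨hplay, hwin⟩
    exact ⟨List.IsChain.left_of_append (l₂ := q) hplay, (List.forall_mem_append.1 hwin).1⟩
  iso_stable := by
    rintro p q ⟨-, hwin⟩ hq hpq
    refine ⟨hq, ?_⟩
    clear hq
    induction hpq with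
    | nil => exact hwin
    | cons hiso _ ih =>
      obtain ⟨hhead, htail⟩ := List.forall_mem_cons.1 hwin
      exact List.forall_mem_cons.2 ⟨hhead.of_iso hiso, ih htail⟩
  welcoming p hp hs V hV :=
    append_singleton_mem_winningPlays hp hV ((hU.finalPos_of_mem_winningPlays hp).of_move hs hV)

theorem Win.isWinning_winningPlays (hU : Win U) : IsWinning U (winningPlays U) := by
  intro p hp hmax
  cases hs : (finalPos U p).sign with
  | O => rfl
  | P =>
    obtain ⟨V, hm, hV⟩ := (hU.finalPos_of_mem_winningPlays hp).exists_move hs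
    simpa using hmax _ (append_singleton_mem_winningPlays hp hm hV) ⟨[V], rfl⟩

theorem exists_isWinning_iff : (∃ S, IsStrategy U S ∧ IsWinning U S) ↔ Win U :=
  ⟨fun ⟨_, hS, hw⟩ => win_of_isWinning hS hw,
    fun h => ⟨_, h.isStrategy_winningPlays, h.isWinning_winningPlays⟩⟩

end Win

/-- Exchange of the two teams. -/
def Sign.swap : Sign → Sign
  | P => O
  | O => P

@[simp] theorem Sign.swap_swap (s : Sign) : s.swap.swap = s := by
  cases s <;> rfl

namespace Pos

/-- Exchange of the two teams in a position. -/
def swap : Pos → Pos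
  | node s Γ => node s.swap (Γ.map fun x => (x.1, x.2.swap))
termination_by t => sizeOf t
decreasing_by exact sizeOf_lt_of_mem ‹_›

theorem swap_node (s : Sign) (Γ : List (Formula × Pos)) :
    (node s Γ).swap = node s.swap (Γ.map fun x => (x.1, x.2.swap)) := by
  rw [swap]

@[simp] theorem swap_swap (t : Pos) : t.swap.swap = t := by
  induction t using induction_on_subtrees with
  | node s Γ ih =>
    have hΓ : ∀ x ∈ Γ, (x.1, x.2.swap.swap) = x := fun x hx => by rw [ih x hx]
    simpa [swap_node, Function.comp_def] using (List.map_congr_left hΓ).trans (List.map_id' Γ)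

theorem sign_swap (t : Pos) : t.swap.sign = t.sign.swap := by
  cases t
  rw [swap_node]
  rfl

theorem Iso.swap {t u : Pos} (h : Iso t u) : Iso t.swap u.swap := by
  induction h with
  | refl => exact .refl _
  | trans _ _ h₁ h₂ => exact h₁.trans h₂
  | perm s h =>
    simp only [swap_node]
    exact .perm _ (h.map _)
  | congr s A Γ _ h =>
    simp only [swap_node]
    exact .congr _ A _ h

theorem BasicMove.swap {t u : Pos} (h : BasicMove t u) : BasicMove t.swap u.swap := by
  cases h with
  | tens s s' A B Γ Θ Γ' Δ hΘ =>
    simp only [swap_node, List.map_cons, List.map_append]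
    exact .tens _ _ A B _ _ _ _ (List.forall_mem_map.2 hΘ)
  | neg s s' A Γ Δ hA =>
    simp only [swap_node, List.map_cons]
    exact .neg _ _ A _ _ hA
  | _ =>
    simp only [swap_node, List.map_cons, List.map_nil]
    constructor

theorem Move.swap {t u : Pos} : Move t u → Move t.swap u.swap
  | ⟨_, _, h₁, h₂, h₃⟩ => ⟨_, _, h₁.swap, h₂.swap, h₃.swap⟩

theorem AllSign.swap {s : Sign} {t : Pos} (h : t.AllSign s) : t.swap.AllSign s.swap := by
  induction h with
  | node Γ _ ih =>
    rw [swap_node]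
    exact .node _ (List.forall_mem_map.2 ih)

end Pos

theorem Win.not_win_swap {t : Pos} (h : Win t) : ¬ Win t.swap := by
  induction h with
  | opponent U hs _ ih =>
    intro h
    obtain ⟨V, hm, hV⟩ := h.exists_move (by rw [sign_swap, hs, Sign.swap])
    exact ih V.swap (by simpa using hm.swap) (by simpa using hV)
  | proponent U V hs hm _ ih =>
    exact fun h => ih (h.of_move (by rw [sign_swap, hs, Sign.swap]) hm.swap)

theorem Valid.not_dual {A : Formula} : Valid A → ¬ Valid A.dual := by
  rintro ⟨⟨s, Γ⟩, hU, hUA⟩ ⟨⟨s', Δ⟩, hV, hVA⟩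
  have hwin : Win (link (node s Γ) A (node s' Δ).swap) :=
    exists_isWinning_iff.1 (hUA _ hV.swap _ .refl)
  have hrepuncture : (link (node s' Δ) A.dual (node s Γ).swap).Repuncture
      (link (node s Γ) A (node s' Δ).swap).swap := by
    have := Repuncture.step (t := link (node s' Δ) A.dual (node s Γ).swap) s' s.swap A.dual Δ
      (Γ.map fun x => (x.1, x.2.swap)) (by rw [swap_node]; exact .refl)
    simpa [link, swap_node, Function.comp_def] using this
  exact hwin.not_win_swap (exists_isWinning_iff.1 (hVA _ hU.swap _ hrepuncture))

section Soundness

theorem exists_perm_mem_prod_map {α β : Type*} (f : α → Language β) {Γ Δ : List α}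
    (h : Γ.Perm Δ) {x : List β} (hx : x ∈ (Γ.map f).prod) :
    ∃ y, x.Perm y ∧ y ∈ (Δ.map f).prod := by
  induction h generalizing x with
  | nil => exact ⟨x, .refl _, hx⟩
  | cons a _ ih =>
    obtain ⟨k, hk, l, hl, rfl⟩ := hx
    obtain ⟨l', hperm, hl'⟩ := ih hl
    exact ⟨k ++ l', hperm.append_left k, Language.append_mem_mul hk hl'⟩
  | swap a b Γ =>
    obtain ⟨k, hk, _, ⟨l, hl, m, hm, rfl⟩, rfl⟩ := hx
    refine ⟨l ++ (k ++ m), ?_, Language.append_mem_mul hl (Language.append_mem_mul hk hm)⟩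
    exact List.perm_append_comm_assoc k l m
  | trans _ _ ih₁ ih₂ =>
    obtain ⟨y, hxy, hy⟩ := ih₁ hx
    obtain ⟨z, hyz, hz⟩ := ih₂ hy
    exact ⟨z, hxy.trans hyz, hz⟩

theorem map_fst_of_mem_prod_tests {Q : Pos → Prop} {Γ : List Formula}
    (hΓ : ∀ A ∈ Γ, A.IsPositive) {l : List (Formula × Pos)}
    (hl : l ∈ (Γ.map (tests Q)).prod) : l.map Prod.fst = Γ := by
  induction Γ generalizing l with
  | nil => exact List.map_eq_nil_iff.2 hl
  | cons A Γ ih =>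
    obtain ⟨hA, hΓ⟩ := List.forall_mem_cons.1 hΓ
    obtain ⟨a, ha, l, hl, rfl⟩ := hl
    obtain ⟨u, rfl, -⟩ := (mem_tests_of_isPositive hA).1 ha
    simp [ih hΓ hl]

/-- Semantic soundness of a sequent: a proponent wins against all the tests of its formulae. -/
def Sound (Γ : List Formula) : Prop :=
  ∀ l ∈ (Γ.map (tests Win)).prod, Win (node .P l)

variable {A B : Formula} {Γ Δ Θ : List Formula} {u : Pos} {k l : List (Formula × Pos)}

theorem sound_cons_iff :
    Sound (A :: Γ) ↔ ∀ l ∈ (Γ.map (tests Win)).prod, Realizes Win A (node .P l) := by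
  simp only [realizes_iff]
  constructor
  · exact fun h l hl a ha => h _ (Language.append_mem_mul ha hl)
  · rintro h _ ⟨a, ha, l, hl, rfl⟩
    exact h l hl a ha

theorem sound_cons_iff_of_isPositive (hA : A.IsPositive) :
    Sound (A :: Γ) ↔ ∀ l ∈ (Γ.map (tests Win)).prod, ∀ u, Realizes Win A.dual u →
      Win (node .P ((A, u) :: l)) := by
  simp only [sound_cons_iff, realizes_iff (A := A), mem_tests_of_isPositive hA]
  refine forall₂_congr fun l _ => ⟨fun h u hu => h _ ⟨u, rfl, hu⟩, ?_⟩
  rintro h _ ⟨u, rfl, hu⟩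
  exact h u hu

theorem Win.cons_of_realizes (h : Realizes Win A (node .P l)) (hu : Realizes Win A.dual u) :
    Win (node .P ((A, u) :: l)) := by
  have hpositive : ∀ {B t v}, B.IsPositive → Realizes Win B t → Realizes Win B.dual v →
      Win (t.attach [(B, v)]) := fun hB ht hv =>
    realizes_iff.1 ht _ ((mem_tests_of_isPositive hB).2 ⟨_, rfl, hv⟩)
  obtain hA | hA := A.isPositive_or_dual
  · exact hpositive hA h hu
  · obtain ⟨s, m⟩ := u
    have hm := BasicMove.neg .P s A.dual l m hA
    rw [dual_dual] at hm
    exact .of_basicMove hm (hpositive hA hu (by rwa [dual_dual]))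

theorem Win.append_of_forall_tests
    (h : ∀ m ∈ ((k.map Prod.fst).map (tests Win)).prod, Win (node .P (m ++ l)))
    (hk : ∀ x ∈ k, Realizes Win x.1.dual x.2) : Win (node .P (k ++ l)) := by
  induction k generalizing l with
  | nil => exact h [] rfl
  | cons x k ih =>
    obtain ⟨hx, hk⟩ := List.forall_mem_cons.1 hk
    refine Win.cons_of_realizes (realizes_iff.2 fun a ha => ?_) hx
    refine .of_perm (List.perm_append_comm_assoc k a l) (ih (fun m hm => ?_) hk)
    refine .of_perm ?_ (h _ (Language.append_mem_mul ha hm))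
    rw [List.append_assoc]
    exact List.perm_append_comm_assoc a m l

theorem Sound.win (h : Sound (l.map Prod.fst)) (hl : ∀ x ∈ l, Realizes Win x.1.dual x.2) :
    Win (node .P l) := by
  rw [← l.append_nil]
  exact .append_of_forall_tests (fun m hm => by simpa using h m hm) hl

theorem Sound.realizes (h : Sound (A :: l.map Prod.fst))
    (hl : ∀ x ∈ l, Realizes Win x.1.dual x.2) : Realizes Win A (node .P l) := by
  refine realizes_iff.2 fun a ha => .of_perm List.perm_append_comm (.append_of_forall_tests ?_ hl)
  exact fun m hm => .of_perm List.perm_append_comm (h _ (Language.append_mem_mul ha hm))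

theorem Sound.of_perm (hperm : Γ.Perm Δ) (h : Sound Γ) : Sound Δ := by
  intro l hl
  obtain ⟨m, hlm, hm⟩ := exists_perm_mem_prod_map (tests Win) hperm.symm hl
  exact .of_perm hlm.symm (h m hm)

theorem Sound.of_decompositions (h : ∀ C ∈ A.decompositions, Sound (C ++ Γ)) :
    Sound (A :: Γ) := by
  refine sound_cons_iff.2 fun l hl => realizes_iff.2 fun a ha => ?_
  refine .append_of_forall_tests (fun m hm => h _ ha.1 _ ?_) ha.2
  rw [List.map_append, List.prod_append]
  exact Language.append_mem_mul hm hl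

theorem Win.cons_of_mem_decompositions (hA : A.IsPositive) (hu : Realizes Win A.dual u)
    {l : List (Formula × List (Formula × Pos))} (hl : l.map Prod.fst ∈ A.dual.decompositions)
    (hreal : ∀ x ∈ l, Realizes Win x.1.dual (node .P x.2)) :
    Win (node .P ((A, u) :: (l.map Prod.snd).flatten)) := by
  refine .of_basicMove (basicMove_attach hA .P u hl) (realizes_iff.1 hu _ ⟨?_, ?_⟩)
  · simpa [Function.comp_def] using hl
  · exact List.forall_mem_map.2 hreal

theorem Sound.one : Sound [one] := by
  refine (sound_cons_iff_of_isPositive (A := .one) trivial).2 ?_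
  rintro _ rfl u hu
  exact Win.cons_of_mem_decompositions (A := .one) (l := []) trivial hu rfl (by simp)

theorem Sound.of_mem_decompositions (hA : A.IsPositive) (hB : [B.dual] ∈ A.dual.decompositions)
    (h : Sound (B :: Γ)) : Sound (A :: Γ) := by
  refine (sound_cons_iff_of_isPositive hA).2 fun l hl u hu => ?_
  simpa using Win.cons_of_mem_decompositions (l := [(B.dual, l)]) hA hu hB
    (by simpa using sound_cons_iff.1 h l hl)

theorem Sound.ax (A : Formula) : Sound [A, A.dual] := by
  induction hn : A.size using Nat.strong_induction_on generalizing A with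
  | _ n ih =>
  wlog hA : A.IsPositive generalizing A with hpositive
  · have := hpositive A.dual (by simpa using hn) (A.isPositive_or_dual.resolve_left hA)
    rw [dual_dual] at this
    exact this.of_perm (.swap _ _ _)
  refine (sound_cons_iff_of_isPositive hA).2 ?_
  rintro _ ⟨b, ⟨hb, hreal⟩, _, rfl, rfl⟩ u hu
  have hcopycat : ∀ x ∈ b, Realizes Win x.1.dual (node .P [x]) := by
    intro x hx
    have hlt : x.1.dual.size < n := by
      rw [← hn, ← A.size_dual, size_dual]
      exact (size_le_sequentSize (List.mem_map_of_mem hx)).trans_lt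
        (sequentSize_lt_of_mem_decompositions (by rwa [dual_dual]) hb)
    have hsound := ih _ hlt _ rfl
    rw [dual_dual] at hsound
    exact Sound.realizes hsound (by simpa using hreal x hx)
  simpa [Function.comp_def, ← List.flatMap_def] using
    Win.cons_of_mem_decompositions (l := b.map fun x => (x.1, [x])) hA hu
      (by simpa [Function.comp_def] using hb) (List.forall_mem_map.2 hcopycat)

theorem Sound.tens (hA : Sound (A :: (Γ ++ Θ.map quest)))
    (hB : Sound (B :: (Δ ++ Θ.map quest))) :
    Sound (Formula.tens A B :: (Γ ++ Δ ++ Θ.map quest)) := by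
  refine (sound_cons_iff_of_isPositive (A := .tens A B) trivial).2 ?_
  simp only [sound_cons_iff, List.map_append (f := tests Win), List.prod_append] at hA hB ⊢
  rintro _ ⟨_, ⟨γ, hγ, δ, hδ, rfl⟩, θ, hθ, rfl⟩ ⟨s, m⟩ hu
  have hquest : ∀ x ∈ θ, ∃ C, x.1 = quest C := by
    have hpositive : ∀ C ∈ Θ.map quest, C.IsPositive := List.forall_mem_map.2 fun _ _ => trivial
    have hfst := map_fst_of_mem_prod_tests hpositive hθ
    intro x hx
    obtain ⟨C, -, hC⟩ := List.mem_map.1 (hfst ▸ List.mem_map_of_mem hx : x.1 ∈ Θ.map quest)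
    exact ⟨C, hC.symm⟩
  refine .of_perm ((perm_append_right_comm γ θ δ).cons _) 
    (.of_basicMove (.tens .P s A B γ θ δ m hquest) ?_)
  refine realizes_iff.1 hu [(A.dual, node .P (γ ++ θ)), (B.dual, node .P (δ ++ θ))] ⟨rfl, ?_⟩
  simp only [List.forall_mem_cons, dual_dual]
  exact ⟨hA _ (Language.append_mem_mul hγ hθ), hB _ (Language.append_mem_mul hδ hθ), by simp⟩

theorem Sound.weakening (A : Formula) (h : Sound Γ) : Sound (quest A :: Γ) :=
  (sound_cons_iff_of_isPositive (A := quest A) trivial).2 fun l hl u _ =>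
    .of_basicMove (.weakening .P A u l) (h l hl)

end Soundness

section Cuts

/-- The formula `?(A ⊗ A⊥)`, which labels an edge to a leaf that is used for a cut on `A`: by a
dereliction and a tensor move a vertex splits into two parts, one holding `A` and the other `A⊥`,
with the former leaf playing copycat between them. -/
def cutFormula (A : Formula) : Formula := quest (Formula.tens A A.dual)

/-- Soundness of a sequent up to finitely many additional cut formulae. -/
def SoundWithCuts (Γ : List Formula) : Prop :=
  ∃ K : List Formula, Sound (Γ ++ K.map cutFormula)

variable {A B : Formula} {Γ Δ Θ : List Formula}

theorem Sound.append_cuts (h : Sound Γ) (K : List Formula) : Sound (Γ ++ K.map cutFormula) := by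
  induction K with
  | nil => simpa using h
  | cons A K ih => exact .of_perm List.perm_middle.symm (ih.weakening _)

theorem SoundWithCuts.of_perm (hperm : Γ.Perm Δ) : SoundWithCuts Γ → SoundWithCuts Δ
  | ⟨K, h⟩ => ⟨K, h.of_perm (hperm.append_right _)⟩

theorem SoundWithCuts.tens :
    SoundWithCuts (A :: (Γ ++ Θ.map quest)) → SoundWithCuts (B :: (Δ ++ Θ.map quest)) →
      SoundWithCuts (Formula.tens A B :: (Γ ++ Δ ++ Θ.map quest))
  | ⟨K, hA⟩, ⟨L, hB⟩ => by
    have hA' : Sound (A :: ((Γ ++ K.map cutFormula) ++ Θ.map quest)) :=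
      hA.of_perm ((perm_append_right_comm _ _ _).cons A)
    have hB' : Sound (B :: ((Δ ++ L.map cutFormula) ++ Θ.map quest)) :=
      hB.of_perm ((perm_append_right_comm _ _ _).cons B)
    refine ⟨K ++ L, (hA'.tens hB').of_perm ?_⟩
    rw [List.cons_append, List.perm_cons]
    simp only [List.map_append, ← Multiset.coe_eq_coe, ← Multiset.coe_add]
    abel

theorem SoundWithCuts.wth :
    SoundWithCuts (A :: Γ) → SoundWithCuts (B :: Γ) → SoundWithCuts (Formula.wth A B :: Γ)
  | ⟨K, hA⟩, ⟨L, hB⟩ => by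
    refine ⟨K ++ L, .of_decompositions ?_⟩
    rintro C (rfl | rfl)
    · simpa using hA.append_cuts L
    · refine (hB.append_cuts K).of_perm ?_
      simp only [List.map_append, List.append_assoc]
      exact List.perm_append_comm.append_left _

theorem SoundWithCuts.cut :
    SoundWithCuts (A :: Γ) → SoundWithCuts (A.dual :: Δ) → SoundWithCuts (Γ ++ Δ) := by
  intro hA hB
  obtain ⟨K, h⟩ := SoundWithCuts.tens (Θ := []) (by simpa using hA) (by simpa using hB)
  rw [List.map_nil, List.append_nil] at h
  exact ⟨A :: K, (Sound.of_mem_decompositions (A := cutFormula A) trivial rfl h).of_perm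
    List.perm_middle.symm⟩

theorem SoundWithCuts.contraction :
    SoundWithCuts (quest A :: quest A :: Γ) → SoundWithCuts (quest A :: Γ)
  | ⟨K, h⟩ => by
    have hpar : SoundWithCuts (Formula.par (quest A) (quest A) :: Γ) :=
      ⟨K, .of_decompositions <| by rintro _ rfl; exact h⟩
    have hax : Sound ((quest A).dual :: ([] ++ [A].map quest)) :=
      (Sound.ax (quest A)).of_perm (.swap _ _ _)
    -- Sharing `?A` between the two identity sequents is what makes contraction a cut.
    have htens : SoundWithCuts ((Formula.par (quest A) (quest A)).dual :: [quest A]) :=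
      ⟨[], hax.tens hax⟩
    exact .of_perm (List.perm_append_singleton _ _) (hpar.cut htens)

theorem Provable.soundWithCuts (h : Provable Γ) : SoundWithCuts Γ := by
  induction h with
  | ax A => exact ⟨[], Sound.ax A⟩
  | cut A Γ Δ _ _ hA hB => exact hA.cut hB
  | exchange Γ Δ hperm _ h => exact h.of_perm hperm
  | one => exact ⟨[], Sound.one⟩
  | bot Γ _ h =>
    obtain ⟨K, h⟩ := h
    exact ⟨K, .of_decompositions <| by rintro _ rfl; exact h⟩
  | top Γ => exact ⟨[], .of_decompositions fun _ hC => hC.elim⟩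
  | tens A B Γ Δ Θ _ _ hA hB => exact hA.tens hB
  | par A B Γ _ h =>
    obtain ⟨K, h⟩ := h
    exact ⟨K, .of_decompositions <| by rintro _ rfl; exact h⟩
  | plusLeft A B Γ _ h =>
    obtain ⟨K, h⟩ := h
    exact ⟨K, .of_mem_decompositions (A := plus A B) trivial (.inl rfl) h⟩
  | plusRight A B Γ _ h =>
    obtain ⟨K, h⟩ := h
    exact ⟨K, .of_mem_decompositions (A := plus A B) trivial (.inr rfl) h⟩
  | wth A B Γ _ _ hA hB => exact hA.wth hB
  | dereliction A Γ _ h =>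
    obtain ⟨K, h⟩ := h
    exact ⟨K, .of_mem_decompositions (A := quest A) trivial rfl h⟩
  | weakening A Γ _ h =>
    obtain ⟨K, h⟩ := h
    exact ⟨K, h.weakening A⟩
  | contraction A Γ _ h => exact h.contraction
  | promotion A Γ _ h =>
    obtain ⟨K, h⟩ := h
    exact ⟨K, .of_decompositions <| by rintro _ rfl; exact h⟩

end Cuts

section Validity

/-- The sequent of every proponent vertex is sound, when the tree is hung by edges labelled `Φ`
from above (`Φ` is empty for a whole position, and a single formula for a subtree). Since only the
sequents of the vertices are involved, the property does not depend on where the token is. -/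
inductive LocallySound : List Formula → Pos → Prop
  | node (s : Sign) (Φ : List Formula) (Γ : List (Formula × Pos)) :
      (s = .P → Sound (Φ ++ Γ.map Prod.fst)) → (∀ x ∈ Γ, LocallySound [x.1.dual] x.2) →
      LocallySound Φ (node s Γ)

variable {Φ : List Formula} {A : Formula} {t u : Pos}

theorem LocallySound.of_iso (h : LocallySound Φ t) (hiso : Iso t u) : LocallySound Φ u := by
  induction h generalizing u with
  | node s Φ Γ hs _ ih =>
    obtain ⟨Δ, rfl, hperm, hsub⟩ := hiso.exists_eq_node
    refine .node _ _ _ (fun hP => (hs hP).of_perm (hperm.append_left _)) fun y hy => ?_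
    obtain ⟨x, hx, hxy, hiso⟩ := hsub y hy
    exact hxy ▸ ih x hx hiso

theorem LocallySound.repuncture (h : LocallySound [] t) (hu : t.Repuncture u) :
    LocallySound [] u := by
  induction hu with
  | refl => exact h
  | iso _ hiso ih => exact ih.of_iso hiso
  | step s s' A Γ Δ _ ih =>
    obtain ⟨_, _, _, hs, hsub⟩ := ih
    obtain ⟨⟨_, _, _, hs', hsub'⟩, hΓ⟩ := List.forall_mem_cons.1 hsub
    refine .node _ _ _ hs' (List.forall_mem_cons.2 ⟨.node _ _ _ (fun hP => ?_) hΓ, hsub'⟩)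
    simpa using hs hP

theorem LocallySound.of_allSign (h : t.AllSign .O) (Φ : List Formula) : LocallySound Φ t := by
  induction h generalizing Φ with
  | node Γ _ ih => exact .node _ _ _ (fun hO => by cases hO) fun x hx => ih x hx _

theorem LocallySound.realizes (h : LocallySound [A] t) : Realizes Win A t := by
  generalize hΦ : [A] = Φ at h
  induction h generalizing A with
  | node s Φ Γ hs _ ih =>
    subst hΦ
    have hΓ : ∀ x ∈ Γ, Realizes Win x.1.dual x.2 := fun x hx => ih x hx rfl
    cases s with
    | P => exact (hs rfl).realizes hΓ
    | O => exact realizes_of_forall_realizes (fun _ _ => Win.of_iso) Win.opponent A hΓ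

theorem LocallySound.win (h : LocallySound [] t) : Win t := by
  obtain ⟨s, _, Γ, hs, hsub⟩ := h
  have hΓ : ∀ x ∈ Γ, Realizes Win x.1.dual x.2 := fun x hx => (hsub x hx).realizes
  cases s with
  | P => exact (hs rfl).win hΓ
  | O => exact holds_of_forall_realizes (fun _ _ => Win.of_iso) Win.opponent hΓ

theorem sound_dual_cutFormula (A : Formula) : Sound [(cutFormula A).dual] := by
  refine .of_decompositions ?_
  rintro _ rfl
  refine .of_decompositions ?_
  rintro _ rfl
  exact Sound.ax A.dual

theorem Provable.valid (h : Provable [A]) : Valid A := by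
  obtain ⟨K, hK⟩ := h.soundWithCuts
  have hleaf : ∀ B ∈ K, LocallySound [(cutFormula B).dual] (node .P []) := fun B _ =>
    .node _ _ _ (fun _ => sound_dual_cutFormula B) (by simp)
  refine ⟨node .P (K.map fun B => (cutFormula B, node .P [])), ?_, fun V hV W hW => ?_⟩
  · exact .node _ (List.forall_mem_map.2 fun _ _ => .node _ (by simp))
  · have hlink : LocallySound [] (link (node .P (K.map fun B => (cutFormula B, node .P []))) A V) :=
      .node _ _ _ (fun _ => by simpa [Function.comp_def] using hK)
        (List.forall_mem_cons.2 ⟨.of_allSign hV _, List.forall_mem_map.2 hleaf⟩)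
    exact exists_isWinning_iff.2 (hlink.repuncture hW).win

end Validity

end LLGame

theorem mainTheorem12 :
    -- all plays are finite
    (¬ ∃ p : ℕ → LLGame.Pos, ∀ n, LLGame.Pos.Move (p n) (p (n + 1))) ∧
    -- validity is consistent
    (∀ A : LLGame.Formula, ¬ (LLGame.Valid A ∧ LLGame.Valid A.dual)) ∧
    -- validity is a model of provability
    (∀ A : LLGame.Formula, LLGame.Provable [A] → LLGame.Valid A) := by
  refine ⟨?_, fun A h => h.1.not_dual h.2, fun A h => h.valid⟩
  rintro ⟨p, hp⟩
  exact (wellFounded_iff_isEmpty_descending_chain.1 LLGame.wellFounded_move).false ⟨p, hp⟩
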